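/- **Notation.** Let $q$ be an indeterminate. For $n\ge 0$ put $[n]=\frac{1-q^n}{1-q}$ and $(q;q)_n=\prod_{i=1}^n(1-q^i)$. For $n\ge 0$ and $k\in\mathbb Z$ the $q$-binomial coefficient is $${n\brack k}=\frac{(q;q)_n}{(q;q)_k\,(q;q)_{n-k}}\in\mathbb Z[q]\quad\text{if }0\le k\le n,\qquad {n\brack k}=0\quad\text{otherwise.}$$ For $0\le k\le n$ put $$A_{n,k}(q)=q^{n-k}\frac{[2k+1]}{[2n+1]}{2n+1\brack n-k}={2n\brack n-k}-{2n\brack n-k-1},\qquad A_{n,k}=A_{n,k}(1)=\frac{2k+1}{2n+1}\binom{2n+1}{n-k},$$ and for $n\ge 1$, $k\ge 0$ let $C_{n,k}=\frac{n-2k}{n}\binom nk\in\mathbb Z$ be the Catalan triangle numbers. For a Laurent polynomial $P(q)$ and a nonzero polynomial $D(q)$ with integer coefficients, $P(q)\equiv 0\pmod{D(q)}$ means that $P(q)/D(q)$ is a Laurent polynomial in $q$ with integer coefficients. **Theorem.** 1. Let $n$ be a positive integer, and let $a,r,j$ be non-negative integers with $a\le n$ and $j\le 2r+1$. Then $$\sum_{k=a}^{n}A_{n,k}(q)^{2r+1}\,q^{j(k^2+k)}\equiv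 0\pmod{{2n\brack n-a}}.$$ 2. Consequently (by setting $q=1$), for every positive integer $n$ and all non-negative integers $a,r$ with $a\le n$, $$\sum_{k=a}^{n}A_{n,k}^{2r+1}\equiv 0\pmod{\binom{2n}{n-a}}.$$ 3. The conjecture of Miana, Ohtsuka and Romero holds: for all positive integers $n,a$ with $n>a$ and every non-negative integer $r$, $$\sum_{k=0}^{a}C_{n,k}^{2r+1}\equiv 0\pmod{\binom{n-1}{a}}.$$ -/

import Mathlib

namespace CatalanTriangle

open Polynomial

/-- The `q`-integer `[n] = (1 - q^n) / (1 - q) = 1 + q + ⋯ + q^(n-1)`, a polynomial in `q = X`. -/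
noncomputable def qInt (n : ℕ) : ℤ[X] := ∑ i ∈ Finset.range n, X ^ i

theorem qInt_mul (n : ℕ) : qInt n * (1 - X) = 1 - X ^ n := by
  have h := geom_sum_mul (X : ℤ[X]) n
  simp only [qInt]
  linear_combination -h

/-- The `q`-shifted factorial `(q;q)_n = (1 - q)(1 - q^2)⋯(1 - q^n)`. -/
noncomputable def qFact (n : ℕ) : ℤ[X] := ∏ i ∈ Finset.range n, (1 - X ^ (i + 1))

theorem one_sub_X_pow_ne_zero (i : ℕ) : (1 - X ^ (i + 1) : ℤ[X]) ≠ 0 := by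
  intro h
  have h2 := congrArg (fun p : ℤ[X] => p.eval 0) h
  simp at h2

theorem qFact_ne_zero (n : ℕ) : qFact n ≠ 0 :=
  Finset.prod_ne_zero_iff.mpr fun i _ => one_sub_X_pow_ne_zero i

theorem qFact_succ (n : ℕ) : qFact (n + 1) = qFact n * (1 - X ^ (n + 1)) :=
  Finset.prod_range_succ _ n

/-- The `q`-binomial coefficient with a natural number as lower index, as a polynomial with integer
coefficients, built by the `q`-Pascal rule. That it is the quotient
`(q;q)_n / ((q;q)_k (q;q)_(n-k))` for `k ≤ n`, and `0` for `k > n`, is proved in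
`qBinomNat_mul` and `qBinomNat_eq_zero` below. -/
noncomputable def qBinomNat : ℕ → ℕ → ℤ[X]
  | _, 0 => 1
  | 0, _ + 1 => 0
  | n + 1, k + 1 => qBinomNat n k + X ^ (k + 1) * qBinomNat n (k + 1)

theorem qBinomNat_zero_right (n : ℕ) : qBinomNat n 0 = 1 := by
  cases n <;> simp [qBinomNat]

theorem qBinomNat_eq_zero {n k : ℕ} (h : n < k) : qBinomNat n k = 0 := by
  induction n generalizing k with
  | zero =>
    obtain ⟨k, rfl⟩ : ∃ j, k = j + 1 := ⟨k - 1, by omega⟩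
    simp [qBinomNat]
  | succ n ih =>
    obtain ⟨k, rfl⟩ : ∃ j, k = j + 1 := ⟨k - 1, by omega⟩
    simp [qBinomNat, ih (show n < k by omega), ih (show n < k + 1 by omega)]

theorem qBinomNat_add_mul (k l : ℕ) :
    qBinomNat (k + l) k * (qFact k * qFact l) = qFact (k + l) := by
  induction hm : k + l generalizing k l with
  | zero =>
    obtain ⟨rfl, rfl⟩ : k = 0 ∧ l = 0 := by omega
    simp [qBinomNat, qFact]
  | succ m ih =>
    rcases k with _ | k
    · obtain rfl : l = m + 1 := by omega
      simp [qBinomNat, qFact]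
    rcases l with _ | l
    · obtain rfl : k = m := by omega
      have h1 := ih k 0 (by omega)
      have h0 : qFact 0 = 1 := by simp [qFact]
      rw [h0] at h1 ⊢
      simp only [qBinomNat, qBinomNat_eq_zero (Nat.lt_succ_self k), qFact_succ]
      linear_combination (1 - X ^ (k + 1)) * h1
    · have h1 := ih k (l + 1) (by omega)
      have h2 := ih (k + 1) l (by omega)
      obtain rfl : m = k + l + 1 := by omega
      rw [qFact_succ l] at h1
      rw [qFact_succ k] at h2
      have h3 : qBinomNat (k + l + 1 + 1) (k + 1)
          = qBinomNat (k + l + 1) k + X ^ (k + 1) * qBinomNat (k + l + 1) (k + 1) := by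
        rw [qBinomNat]
      rw [qFact_succ (k + l + 1), qFact_succ k, qFact_succ l, h3]
      linear_combination (1 - X ^ (k + 1)) * h1 + X ^ (k + 1) * (1 - X ^ (l + 1)) * h2

theorem qBinomNat_mul {n k : ℕ} (h : k ≤ n) :
    qBinomNat n k * (qFact k * qFact (n - k)) = qFact n := by
  obtain ⟨l, rfl⟩ := Nat.exists_eq_add_of_le h
  rw [Nat.add_sub_cancel_left]
  exact qBinomNat_add_mul k l

/-- The `q`-binomial coefficient `[n choose k]` with an integer lower index: it is `0` unless
`0 ≤ k ≤ n`. -/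
noncomputable def qBinom (n : ℕ) (k : ℤ) : ℤ[X] :=
  if 0 ≤ k then qBinomNat n k.toNat else 0

/-- `A_{n,k}(q) = [2n choose n-k] - [2n choose n-k-1]`, with `[2n choose -1] = 0`. -/
noncomputable def qA (n k : ℕ) : ℤ[X] :=
  qBinom (2 * n) ((n : ℤ) - k) - qBinom (2 * n) ((n : ℤ) - k - 1)

/-- The other expression for `A_{n,k}(q)`, namely
`A_{n,k}(q) = q^(n-k) ([2k+1]/[2n+1]) [2n+1 choose n-k]`. -/
theorem qInt_mul_qA {n k : ℕ} (h : k ≤ n) :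
    qInt (2 * n + 1) * qA n k
      = X ^ (n - k) * qInt (2 * k + 1) * qBinom (2 * n + 1) ((n : ℤ) - k) := by
  obtain ⟨m, rfl⟩ := Nat.exists_eq_add_of_le h
  have e1 : ((k + m : ℕ) : ℤ) - k = (m : ℤ) := by push_cast; ring
  rw [qA, e1, Nat.add_sub_cancel_left]
  rcases m with _ | m
  · simp [qBinom, qBinomNat_zero_right]
  · have e2 : ((m + 1 : ℕ) : ℤ) - 1 = (m : ℤ) := by push_cast; ring
    rw [e2]
    simp only [qBinom, Int.natCast_nonneg, if_true, Int.toNat_natCast]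
    have h1 := qBinomNat_add_mul (m + 1) (2 * k + m + 1)
    have h2 := qBinomNat_add_mul m (2 * k + m + 2)
    have h3 := qBinomNat_add_mul (m + 1) (2 * k + m + 2)
    rw [show m + 1 + (2 * k + m + 1) = 2 * (k + (m + 1)) by ring] at h1
    rw [show m + (2 * k + m + 2) = 2 * (k + (m + 1)) by ring] at h2
    rw [show m + 1 + (2 * k + m + 2) = 2 * (k + (m + 1)) + 1 by ring] at h3
    have i1 := qInt_mul (2 * (k + (m + 1)) + 1)
    have i2 := qInt_mul (2 * k + 1)
    rw [qFact_succ (2 * (k + (m + 1))), qFact_succ m, qFact_succ (2 * k + m + 1)] at h3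
    rw [qFact_succ m] at h1
    rw [qFact_succ (2 * k + m + 1)] at h2
    have hne : (qFact m * (1 - X ^ (m + 1))) * (qFact (2 * k + m + 1) * (1 - X ^ (2 * k + m + 1 + 1)))
        * (1 - X ^ (0 + 1)) ≠ 0 :=
      mul_ne_zero (mul_ne_zero (mul_ne_zero (qFact_ne_zero _) (one_sub_X_pow_ne_zero _))
        (mul_ne_zero (qFact_ne_zero _) (one_sub_X_pow_ne_zero _))) (one_sub_X_pow_ne_zero 0)
    apply mul_right_cancel₀ hne
    generalize qBinomNat (2 * (k + (m + 1))) (m + 1) = b1 at *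
    generalize qBinomNat (2 * (k + (m + 1))) m = b2 at *
    generalize qBinomNat (2 * (k + (m + 1)) + 1) (m + 1) = b3 at *
    generalize qInt (2 * (k + (m + 1)) + 1) = u at *
    generalize qInt (2 * k + 1) = v at *
    generalize qFact (2 * (k + (m + 1))) = F at *
    generalize qFact m = G at *
    generalize qFact (2 * k + m + 1) = H at *
    linear_combination u * (1 - X) * (1 - X ^ (2 * k + m + 1 + 1)) * h1
      - u * (1 - X) * (1 - X ^ (m + 1)) * h2 - X ^ (m + 1) * v * (1 - X) * h3
      + F * (X ^ (m + 1) - X ^ (2 * k + m + 2)) * i1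
      - X ^ (m + 1) * F * (1 - X ^ (2 * (k + (m + 1)) + 1)) * i2

/-- `P(q) ≡ 0 (mod D(q))` for a Laurent polynomial `P` and a polynomial `D`: the quotient `P / D` is
again a Laurent polynomial (here: with integer coefficients). -/
def QCongZero (P : LaurentPolynomial ℤ) (D : ℤ[X]) : Prop :=
  ∃ Q : LaurentPolynomial ℤ, P = toLaurent D * Q

/-- The Catalan triangle number `C_{n,k} = ((n-2k)/n) (n choose k)` of Miana, Ohtsuka and Romero;
for `n ≥ 1` the division is exact, see `mul_cNum` and `cNum_cast`. -/
def cNum (n k : ℕ) : ℤ := ((n : ℤ) - 2 * k) * (n.choose k : ℤ) / (n : ℤ)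

/-- `A_{n,k} = ((2k+1)/(2n+1)) (2n+1 choose n-k)`; for `k ≤ n` the division is exact, see
`mul_aNum` and `aNum_cast`. -/
def aNum (n k : ℕ) : ℤ := (2 * (k : ℤ) + 1) * ((2 * n + 1).choose (n - k) : ℤ) / (2 * (n : ℤ) + 1)

theorem mul_cNum {n : ℕ} (hn : 1 ≤ n) (k : ℕ) :
    (n : ℤ) * cNum n k = ((n : ℤ) - 2 * k) * (n.choose k : ℤ) := by
  apply Int.mul_ediv_cancel'
  obtain ⟨m, rfl⟩ : ∃ m, n = m + 1 := ⟨n - 1, by omega⟩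
  rcases k with _ | k
  · simp
  · have h := Nat.add_one_mul_choose_eq m k
    refine ⟨((m + 1).choose (k + 1) : ℤ) - 2 * (m.choose k : ℤ), ?_⟩
    have h' : ((m : ℤ) + 1) * (m.choose k : ℤ) = ((m + 1).choose (k + 1) : ℤ) * ((k : ℤ) + 1) := by
      exact_mod_cast h
    push_cast
    linear_combination 2 * h'

theorem cNum_cast {n : ℕ} (hn : 1 ≤ n) (k : ℕ) :
    (cNum n k : ℚ) = ((n : ℚ) - 2 * k) / n * (n.choose k : ℚ) := by
  have h : (n : ℚ) * cNum n k = ((n : ℚ) - 2 * k) * (n.choose k : ℚ) := by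
    exact_mod_cast mul_cNum hn k
  have hn' : (n : ℚ) ≠ 0 := by positivity
  field_simp
  linear_combination h

/-- `A_{n,k} = C_{2n+1,n-k}`. -/
theorem aNum_eq_cNum {n k : ℕ} (h : k ≤ n) : aNum n k = cNum (2 * n + 1) (n - k) := by
  unfold aNum cNum
  congr 2
  · push_cast [h]; ring

theorem mul_aNum {n k : ℕ} (h : k ≤ n) :
    (2 * (n : ℤ) + 1) * aNum n k = (2 * (k : ℤ) + 1) * ((2 * n + 1).choose (n - k) : ℤ) := by
  have h1 := mul_cNum (show 1 ≤ 2 * n + 1 by omega) (n - k)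
  rw [← aNum_eq_cNum h] at h1
  push_cast [h] at h1
  linear_combination h1

theorem aNum_cast {n k : ℕ} (h : k ≤ n) :
    (aNum n k : ℚ) = (2 * (k : ℚ) + 1) / (2 * n + 1) * ((2 * n + 1).choose (n - k) : ℚ) := by
  have h1 : (2 * (n : ℚ) + 1) * aNum n k = (2 * (k : ℚ) + 1) * ((2 * n + 1).choose (n - k) : ℚ) := by
    exact_mod_cast mul_aNum h
  have hn' : (2 * (n : ℚ) + 1) ≠ 0 := by positivity
  field_simp
  linear_combination h1

end CatalanTriangle

namespace CatalanTriangle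

open Polynomial LaurentPolynomial

/-! Put M = 2n, p = n - k. Then A_{n,k}(q) = D(p) := [M, p] - [M, p-1], and the sum runs over p ≤ n
- a. Two facts about the functions B_s(p) = [p, s][M+1-p, s] carry the proof. Telescoping
(`sum_lCatalan_mul`): the sum of D(p) B_s(p) over p ≤ a is q^s [M, a][a, s][M-a, s], a multiple of
[M, a]. By linearity this holds for every f in the span of the B_s over Laurent polynomials. Closure
(`binomPair_mul_mem`): by q-Pfaff–Saalschütz the span of the B_s is a ring. It remains to see that
D(p)^2 (`lCatalan_sq_mem`) and q^{-p(M+1-p)} (`T_neg_mul_mem`) lie in this ring. Then D^{2r+1}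
q^{-jp(M+1-p)} is D times an element of the ring, and k^2 + k = n(n+1) - p(M+1-p). Setting q = 1
gives the integer statements; arbitrary M covers all Catalan triangle numbers. -/

/-! ### Elementary identities for q-binomial coefficients. -/

/-- The `q`-binomial coefficient `[n choose k]` as a Laurent polynomial in `q = T 1`. -/
noncomputable def lBinom (n k : ℕ) : LaurentPolynomial ℤ := toLaurent (qBinomNat n k)

theorem lBinom_zero_right (n : ℕ) : lBinom n 0 = 1 := by simp [lBinom, qBinomNat_zero_right]

theorem lBinom_self (n : ℕ) : lBinom n n = 1 := by
  have h := qBinomNat_mul (le_refl n)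
  simp only [Nat.sub_self, show qFact 0 = 1 by simp [qFact], mul_one] at h
  rw [lBinom, mul_right_cancel₀ (qFact_ne_zero n) (h.trans (one_mul _).symm), map_one]

theorem lBinom_eq_zero {n k : ℕ} (h : n < k) : lBinom n k = 0 := by
  simp [lBinom, qBinomNat_eq_zero h]

theorem lBinom_succ_succ (n k : ℕ) :
    lBinom (n + 1) (k + 1) = lBinom n k + T ((k : ℤ) + 1) * lBinom n (k + 1) := by
  rw [lBinom, qBinomNat]
  simp only [lBinom, map_add, map_mul, toLaurent_X_pow]
  push_cast
  rfl

/-- The `q`-factorial `(q;q)_n` as a Laurent polynomial. -/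
noncomputable def lFact (n : ℕ) : LaurentPolynomial ℤ := toLaurent (qFact n)

theorem lFact_ne_zero (n : ℕ) : lFact n ≠ 0 := toLaurent_ne_zero.mpr (qFact_ne_zero n)

theorem lFact_succ (n : ℕ) : lFact (n + 1) = lFact n * (1 - T ((n : ℤ) + 1)) := by
  simp only [lFact, qFact_succ, map_mul, map_sub, map_one, toLaurent_X_pow]
  push_cast
  rfl

theorem lBinom_add_mul (k l : ℕ) : lBinom (k + l) k * (lFact k * lFact l) = lFact (k + l) := by
  simp only [lBinom, lFact, ← map_mul, qBinomNat_add_mul]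

theorem lBinom_add_symm (k l : ℕ) : lBinom (k + l) k = lBinom (k + l) l := by
  apply mul_right_cancel₀ (mul_ne_zero (lFact_ne_zero k) (lFact_ne_zero l))
  have h := lBinom_add_mul l k
  rw [add_comm l k] at h
  linear_combination lBinom_add_mul k l - h

theorem one_sub_T_ne_zero (n : ℕ) : (1 - T ((n : ℤ) + 1) : LaurentPolynomial ℤ) ≠ 0 := by
  have h := lFact_ne_zero (n + 1)
  rw [lFact_succ] at h
  exact right_ne_zero_of_mul h

theorem lBinom_succ_succ_mul (n k : ℕ) :
    lBinom (n + 1) (k + 1) * (1 - T ((k : ℤ) + 1)) = lBinom n k * (1 - T ((n : ℤ) + 1)) := by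
  rcases le_or_gt k n with h | h
  · obtain ⟨l, rfl⟩ := Nat.exists_eq_add_of_le h
    apply mul_right_cancel₀ (mul_ne_zero (lFact_ne_zero k) (lFact_ne_zero l))
    have h1 := lBinom_add_mul (k + 1) l
    have h2 := lBinom_add_mul k l
    rw [show k + 1 + l = k + l + 1 by ring, lFact_succ, lFact_succ] at h1
    linear_combination h1 - (1 - T (((k + l : ℕ) : ℤ) + 1)) * h2
  · simp [lBinom_eq_zero h, lBinom_eq_zero (Nat.succ_lt_succ h)]

theorem lBinom_succ_left_mul (n k : ℕ) :
    lBinom (n + 1) k * (1 - T ((n : ℤ) + 1 - k)) = lBinom n k * (1 - T ((n : ℤ) + 1)) := by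
  rcases lt_trichotomy k (n + 1) with h | rfl | h
  · obtain ⟨l, rfl⟩ := Nat.exists_eq_add_of_le (Nat.le_of_lt_succ h)
    apply mul_right_cancel₀ (mul_ne_zero (lFact_ne_zero k) (lFact_ne_zero l))
    have h1 := lBinom_add_mul k (l + 1)
    have h2 := lBinom_add_mul k l
    rw [← add_assoc, lFact_succ, lFact_succ] at h1
    rw [show (((k + l : ℕ) : ℤ) + 1 - k) = (l : ℤ) + 1 by push_cast; ring]
    linear_combination h1 - (1 - T (((k + l : ℕ) : ℤ) + 1)) * h2
  · simp [lBinom_eq_zero (Nat.lt_succ_self n)]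
  · simp [lBinom_eq_zero h, lBinom_eq_zero (Nat.lt_of_succ_lt h)]

/-- Split 1 - q^{n+1} = (1 - q^{n-k}) + q^{n-k}(1 - q^{k+1}) and absorb each factor. This is the
Pascal rule needed in base q^{-1}. -/
theorem lBinom_succ_succ' (n k : ℕ) :
    lBinom (n + 1) (k + 1) = T ((n : ℤ) - k) * lBinom n k + lBinom n (k + 1) := by
  rcases le_or_gt k n with h | h
  · apply mul_right_cancel₀ (one_sub_T_ne_zero n)
    have h1 := lBinom_succ_succ_mul n k
    have h2 := lBinom_succ_left_mul n (k + 1)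
    rw [show (n : ℤ) + 1 - (k + 1 : ℕ) = (n : ℤ) - k by push_cast; ring] at h2
    have h3 : (T ((n : ℤ) + 1) : LaurentPolynomial ℤ) = T ((n : ℤ) - k) * T ((k : ℤ) + 1) := by
      rw [← T_add]; congr 1; ring
    linear_combination T ((n : ℤ) - k) * h1 + h2 - lBinom (n + 1) (k + 1) * h3
  · simp [lBinom_eq_zero h, lBinom_eq_zero (Nat.succ_lt_succ h), lBinom_eq_zero (Nat.lt_succ_of_lt h)]

theorem lBinom_mul_lBinom (n k i : ℕ) :
    lBinom n (k + i) * lBinom (k + i) k = lBinom n k * lBinom (n - k) i := by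
  rcases lt_or_ge n k with h | h
  · simp [lBinom_eq_zero h, lBinom_eq_zero (Nat.lt_add_right i h)]
  obtain ⟨m, rfl⟩ := Nat.exists_eq_add_of_le h
  rw [Nat.add_sub_cancel_left]
  rcases lt_or_ge m i with h | h
  · simp [lBinom_eq_zero h, lBinom_eq_zero (Nat.add_lt_add_left h k)]
  obtain ⟨l, rfl⟩ := Nat.exists_eq_add_of_le h
  have h1 := lBinom_add_mul (k + i) l
  have h2 := lBinom_add_mul k i
  have h3 := lBinom_add_mul k (i + l)
  have h4 := lBinom_add_mul i l
  rw [add_assoc] at h1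
  apply mul_right_cancel₀ (mul_ne_zero (mul_ne_zero (lFact_ne_zero k) (lFact_ne_zero i))
    (lFact_ne_zero l))
  linear_combination lBinom (k + (i + l)) (k + i) * lFact l * h2 + h1
    - h3 - lBinom (k + (i + l)) k * lFact k * h4

theorem lBinom_mul_lBinom' (n k i : ℕ) :
    lBinom n (k + i) * lBinom (k + i) i = lBinom n k * lBinom (n - k) i := by
  rw [← lBinom_add_symm, lBinom_mul_lBinom]

/-! ### q-Vandermonde and q-Pfaff–Saalschütz. -/

/-- The `q`-Vandermonde convolution. -/
theorem lBinom_add_left (m n k : ℕ) :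
    lBinom (m + n) k = ∑ x ∈ Finset.HasAntidiagonal.antidiagonal k,
      T ((x.2 : ℤ) * ((m : ℤ) - x.1)) * lBinom m x.1 * lBinom n x.2 := by
  induction m generalizing k with
  | zero =>
    rw [Finset.sum_eq_single (0, k)]
    · simp [lBinom_zero_right]
    · rintro ⟨i, j⟩ hx hne
      rcases i with _ | i
      · simp at hx hne; omega
      · simp [lBinom_eq_zero (Nat.succ_pos i)]
    · simp
  | succ m ih =>
    rcases k with _ | k
    · simp [lBinom_zero_right]
    rw [show m + 1 + n = m + n + 1 by ring, lBinom_succ_succ, ih k, ih (k + 1),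
      Finset.Nat.sum_antidiagonal_succ, Finset.Nat.sum_antidiagonal_succ, mul_add, Finset.mul_sum,
      add_left_comm, ← Finset.sum_add_distrib]
    congr 1
    · simp only [lBinom_zero_right, mul_one, ← mul_assoc, ← T_add]
      congr 2
      push_cast; ring
    · apply Finset.sum_congr rfl
      rintro ⟨i, j⟩ hx
      have hx : i + j = k := by simpa using hx
      simp only [lBinom_succ_succ, ← hx]
      have e1 : (T ((j : ℤ) * ((m + 1 : ℕ) - (i + 1 : ℕ))) : LaurentPolynomial ℤ)
          = T ((j : ℤ) * (m - i)) := by congr 1; push_cast; ring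
      have e2 : (T (((i + j : ℕ) : ℤ) + 1) * T ((j : ℤ) * (m - (i + 1 : ℕ))) :
          LaurentPolynomial ℤ) = T ((j : ℤ) * (m - i)) * T ((i : ℤ) + 1) := by
        rw [← T_add, ← T_add]; congr 1; push_cast; ring
      rw [e1]
      linear_combination lBinom m (i + 1) * lBinom n j * e2

theorem lBinom_add_left_range (m n k : ℕ) :
    lBinom (m + n) k = ∑ i ∈ Finset.range (k + 1),
      T (((k : ℤ) - i) * ((m : ℤ) - i)) * lBinom m i * lBinom n (k - i) := by
  rw [lBinom_add_left, Finset.Nat.sum_antidiagonal_eq_sum_range_succ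
    (fun i j => T ((j : ℤ) * ((m : ℤ) - i)) * lBinom m i * lBinom n j)]
  apply Finset.sum_congr rfl
  intro i hi
  rw [Nat.cast_sub (Nat.lt_succ_iff.mp (Finset.mem_range.mp hi))]

theorem lBinom_add_left_range' {m k : ℕ} (n : ℕ) (h : m ≤ k) :
    lBinom (m + n) k = ∑ i ∈ Finset.range (m + 1),
      T ((i : ℤ) * ((n : ℤ) - (k - i))) * lBinom m i * lBinom n (k - i) := by
  rw [add_comm, lBinom_add_left, Finset.Nat.sum_antidiagonal_eq_sum_range_succ
    (fun i j => T ((j : ℤ) * ((n : ℤ) - i)) * lBinom n i * lBinom m j),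
    ← Finset.sum_range_reflect]
  symm
  apply Finset.sum_subset_zero_on_sdiff (Finset.range_subset_range.mpr (by omega))
  · intro i hi
    simp only [Finset.mem_sdiff, Finset.mem_range] at hi
    rw [show k - (k + 1 - 1 - i) = i by omega, lBinom_eq_zero (show m < i by omega), mul_zero]
  · intro i hi
    have hi : i ≤ k := by have := Finset.mem_range.mp hi; omega
    rw [show k + 1 - 1 - i = k - i by omega, show k - (k - i) = i by omega, Nat.cast_sub hi]
    ring

/-- The `q`-Pfaff–Saalschütz summation in binomial form. -/
theorem sum_lBinom_mul_lBinom_mul_lBinom (x y : ℕ) {a b : ℕ} (h : a ≤ b) :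
    ∑ k ∈ Finset.range (a + 1), T (((a : ℤ) - k) * ((b : ℤ) - k)) *
        lBinom (x + y + k) k * lBinom x (a - k) * lBinom y (b - k)
      = lBinom (x + b) a * lBinom (y + a) b := by
  -- Vandermonde on [b+x, a], then [y+a, b][b, k] = [y+a, k][y+a-k, b-k] and Vandermonde again on
  -- (a-k) + y. After exchanging the sums, the sum over k is once more a Vandermonde sum (`h2`).
  have key : lBinom (x + b) a * lBinom (y + a) b = ∑ k ∈ Finset.range (a + 1),
      ∑ j ∈ Finset.Ico k (a + 1), T (((a : ℤ) - j) * ((b : ℤ) - j)) * lBinom y (b - j) *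
        (T (((j : ℤ) - k) * ((y : ℤ) + a - k)) *
          (lBinom (y + a) k * (lBinom x (a - k) * lBinom (a - k) (j - k)))) := by
    rw [add_comm x b, lBinom_add_left_range, Finset.sum_mul]
    apply Finset.sum_congr rfl
    intro k hk
    have hk : k ≤ a := Nat.lt_succ_iff.mp (Finset.mem_range.mp hk)
    have h1 := lBinom_mul_lBinom (y + a) k (b - k)
    rw [show k + (b - k) = b by omega, show y + a - k = a - k + y by omega,
      lBinom_add_left_range' y (show a - k ≤ b - k by omega)] at h1
    rw [Finset.sum_Ico_eq_sum_range, show a + 1 - k = a - k + 1 by omega]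
    calc _ = T (((a : ℤ) - k) * ((b : ℤ) - k)) * lBinom x (a - k) *
          (lBinom (y + a) b * lBinom b k) := by ring
      _ = _ := by
        rw [h1, Finset.mul_sum, Finset.mul_sum]
        apply Finset.sum_congr rfl
        intro i hi
        rw [show b - k - i = b - (k + i) by omega, Nat.add_sub_cancel_left,
          Nat.cast_sub (show k ≤ b by omega)]
        have e : (T (((a : ℤ) - k) * ((b : ℤ) - k)) * T ((i : ℤ) * (y - ((b : ℤ) - k - i))) :
            LaurentPolynomial ℤ) = T (((a : ℤ) - (k + i : ℕ)) * ((b : ℤ) - (k + i : ℕ))) *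
              T ((((k + i : ℕ) : ℤ) - k) * ((y : ℤ) + a - k)) := by
          rw [← T_add, ← T_add]; congr 1; push_cast; ring
        linear_combination lBinom x (a - k) * lBinom (y + a) k * lBinom (a - k) i *
          lBinom y (b - (k + i)) * e
  rw [key, Finset.sum_comm' (t' := Finset.range (a + 1)) (s' := fun j => Finset.range (j + 1))
    (by intro k j; simp only [Finset.mem_range, Finset.mem_Ico]; omega)]
  apply Finset.sum_congr rfl
  intro j hj
  have hj : j ≤ a := Nat.lt_succ_iff.mp (Finset.mem_range.mp hj)
  rw [← Finset.mul_sum]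
  have h2 : lBinom (x + y + j) j * lBinom x (a - j) = ∑ k ∈ Finset.range (j + 1),
      T (((j : ℤ) - k) * ((y : ℤ) + a - k)) *
          (lBinom (y + a) k * (lBinom x (a - k) * lBinom (a - k) (j - k))) := by
    rcases lt_or_ge x (a - j) with hx | hx
    · rw [lBinom_eq_zero hx, mul_zero]
      symm
      apply Finset.sum_eq_zero
      intro k hk
      have hk := Finset.mem_range.mp hk
      rw [lBinom_eq_zero (show x < a - k by omega), zero_mul, mul_zero, mul_zero]
    · rw [show x + y + j = y + a + (x - (a - j)) by omega, lBinom_add_left_range, Finset.sum_mul]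
      apply Finset.sum_congr rfl
      intro k hk
      have hk := Finset.mem_range.mp hk
      have h3 := lBinom_mul_lBinom' x (a - j) (j - k)
      rw [show a - j + (j - k) = a - k by omega] at h3
      rw [h3]
      push_cast
      ring
  linear_combination T (((a : ℤ) - j) * ((b : ℤ) - j)) * lBinom y (b - j) * h2

/-! ### The algebra spanned by the functions B_s. -/

/-- The function `p ↦ [p choose s] [M + 1 - p choose s]` on `0 ≤ p ≤ M`. -/
noncomputable def binomPair (M s : ℕ) : Fin (M + 1) → LaurentPolynomial ℤ :=
  fun p => lBinom p s * lBinom (M + 1 - p) s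

theorem mem_span_binomPair {M : ℕ} {f : Fin (M + 1) → LaurentPolynomial ℤ} (K : ℕ)
    (c : ℕ → LaurentPolynomial ℤ)
    (h : ∀ p, f p = ∑ s ∈ Finset.range K, c s * binomPair M s p) :
    f ∈ Submodule.span (LaurentPolynomial ℤ) (Set.range (binomPair M)) := by
  have hf : f = ∑ s ∈ Finset.range K, c s • binomPair M s := by
    ext1 p
    simp [h p, Finset.sum_apply]
  rw [hf]
  exact Submodule.sum_mem _ fun s _ =>
    Submodule.smul_mem _ _ (Submodule.subset_span (Set.mem_range_self s))

/-- Saalschütz with x = p - s, y = M+1-p-t expands the cross product [p, t][M+1-p, s]. Its factor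
[x+y+k, k] does not involve p, since x + y + k = M+1-(s+t-k); the other factors merge with [p,
s][M+1-p, t] into B_{s+t-k}(p). -/
theorem binomPair_mul_binomPair_eq_sum {M s t : ℕ} (h : t ≤ s) (p : Fin (M + 1)) :
    binomPair M s p * binomPair M t p = ∑ k ∈ Finset.range (t + 1),
      T (((t : ℤ) - k) * ((s : ℤ) - k)) * lBinom (M + 1 - (s + t - k)) k *
        lBinom (s + t - k) s * lBinom (s + t - k) t * binomPair M (s + t - k) p := by
  obtain ⟨p, hp⟩ := p
  simp only [binomPair]
  by_cases hs : s ≤ p ∧ s ≤ M + 1 - p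
  · have hG := sum_lBinom_mul_lBinom_mul_lBinom (p - s) (M + 1 - p - t) h
    rw [show p - s + s = p by omega, show M + 1 - p - t + t = M + 1 - p by omega] at hG
    calc _ = lBinom p s * lBinom (M + 1 - p) t * (lBinom p t * lBinom (M + 1 - p) s) := by ring
      _ = _ := by
        rw [← hG, Finset.mul_sum]
        apply Finset.sum_congr rfl
        intro k hk
        have hk : k ≤ t := Nat.lt_succ_iff.mp (Finset.mem_range.mp hk)
        have h1 := lBinom_mul_lBinom p s (t - k)
        have h2 := lBinom_mul_lBinom (M + 1 - p) t (s - k)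
        rw [show s + (t - k) = s + t - k by omega] at h1
        rw [show t + (s - k) = s + t - k by omega] at h2
        rw [show p - s + (M + 1 - p - t) + k = M + 1 - (s + t - k) by omega]
        linear_combination -T (((t : ℤ) - k) * ((s : ℤ) - k)) * lBinom (M + 1 - (s + t - k)) k *
          (lBinom p s * lBinom (p - s) (t - k) * h2 +
            lBinom (M + 1 - p) (s + t - k) * lBinom (s + t - k) t * h1)
  -- Here the natural subtractions may truncate, but both sides vanish because every index s + t - k
  -- is at least s.
  · have hz : ∀ u, s ≤ u → lBinom p u * lBinom (M + 1 - p) u = 0 := by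
      intro u hu
      rcases not_and_or.mp hs with h' | h'
      · rw [lBinom_eq_zero (show p < u by omega), zero_mul]
      · rw [lBinom_eq_zero (show M + 1 - p < u by omega), mul_zero]
    rw [hz s le_rfl, zero_mul]
    symm
    apply Finset.sum_eq_zero
    intro k hk
    have hk := Finset.mem_range.mp hk
    rw [hz _ (by omega), mul_zero]

theorem binomPair_mul_mem {M s t : ℕ} : binomPair M s * binomPair M t ∈
    Submodule.span (LaurentPolynomial ℤ) (Set.range (binomPair M)) := by
  wlog h : t ≤ s generalizing s t
  · rw [mul_comm]
    exact this (by omega)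
  have hf : binomPair M s * binomPair M t = ∑ k ∈ Finset.range (t + 1),
      (T (((t : ℤ) - k) * ((s : ℤ) - k)) * lBinom (M + 1 - (s + t - k)) k *
        lBinom (s + t - k) s * lBinom (s + t - k) t) • binomPair M (s + t - k) := by
    ext1 p
    simp only [Pi.mul_apply, binomPair_mul_binomPair_eq_sum h p, Finset.sum_apply, Pi.smul_apply,
      smul_eq_mul]
  rw [hf]
  exact Submodule.sum_mem _ fun k _ =>
    Submodule.smul_mem _ _ (Submodule.subset_span (Set.mem_range_self _))

/-- The linear span of the functions `binomPair M s`, which is closed under multiplication. -/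
noncomputable def binomPairAlgebra (M : ℕ) :
    Subalgebra (LaurentPolynomial ℤ) (Fin (M + 1) → LaurentPolynomial ℤ) :=
  (Submodule.span (LaurentPolynomial ℤ) (Set.range (binomPair M))).toSubalgebra
    (Submodule.subset_span ⟨0, by ext1 p; simp [binomPair, lBinom_zero_right]⟩)
    (fun f g hf hg => by
      have h := Submodule.mul_mem_mul hf hg
      rw [Submodule.span_mul_span] at h
      refine Submodule.span_le.mpr ?_ h
      rintro _ ⟨_, ⟨s, rfl⟩, _, ⟨t, rfl⟩, rfl⟩
      exact binomPair_mul_mem)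

theorem mem_binomPairAlgebra {M : ℕ} {f : Fin (M + 1) → LaurentPolynomial ℤ} :
    f ∈ binomPairAlgebra M ↔
      f ∈ Submodule.span (LaurentPolynomial ℤ) (Set.range (binomPair M)) := Iff.rfl

/-! ### The powers q^{±p(M+1-p)} lie in the algebra. -/

/-- Cauchy's expansion of a power in the polynomials `(x - 1)(x - q)⋯(x - q^(s-1))`. -/
theorem pow_eq_sum_prod_sub_pow {R : Type*} [CommRing R] (q x : R) (b : ℕ → ℕ → R)
    (h0 : ∀ n, b n 0 = 1) (hz : ∀ n k, n < k → b n k = 0)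
    (hs : ∀ n k, b (n + 1) (k + 1) = b n k + q ^ (k + 1) * b n (k + 1)) {n K : ℕ} (hK : n < K) :
    x ^ n = ∑ s ∈ Finset.range K, b n s * ∏ i ∈ Finset.range s, (x - q ^ i) := by
  rw [Finset.eventually_constant_sum (N := n + 1)
    (fun s hs => by rw [hz n s (by omega), zero_mul]) hK]
  clear hK K
  induction n with
  | zero => simp [h0]
  | succ n ih =>
    -- Multiplying by x = (x - q^s) + q^s yields two sums; this one is shifted to match the second
    -- term of the Pascal rule `hs`.
    have e : ∑ s ∈ Finset.range (n + 1), q ^ s * b n s * ∏ i ∈ Finset.range s, (x - q ^ i) =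
        ∑ s ∈ Finset.range (n + 1),
          q ^ (s + 1) * b n (s + 1) * ∏ i ∈ Finset.range (s + 1), (x - q ^ i) + 1 := by
      rw [Finset.sum_range_succ', Finset.sum_range_succ _ n, hz n (n + 1) (by omega)]
      simp [h0]
    rw [Finset.sum_range_succ']
    simp only [hs, add_mul, Finset.sum_add_distrib, h0, Finset.range_zero, Finset.prod_empty,
      mul_one]
    rw [add_assoc, ← e, ← Finset.sum_add_distrib, pow_succ, ih, Finset.sum_mul]
    apply Finset.sum_congr rfl
    intro s _
    rw [Finset.prod_range_succ]
    ring

/-- Raising n and s together multiplies the left product by (q^{n+1} - 1)q^s, so the ratio to the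
case n = s obeys the absorption rule. -/
theorem prod_T_sub_T (n s : ℕ) :
    ∏ i ∈ Finset.range s, (T (n : ℤ) - T (i : ℤ) : LaurentPolynomial ℤ) =
      lBinom n s * ∏ i ∈ Finset.range s, (T (s : ℤ) - T (i : ℤ)) := by
  have step : ∀ n s : ℕ,
      ∏ i ∈ Finset.range (s + 1), (T ((n + 1 : ℕ) : ℤ) - T (i : ℤ) : LaurentPolynomial ℤ) =
        (T ((n : ℤ) + 1) - 1) * T (s : ℤ) * ∏ i ∈ Finset.range s, (T (n : ℤ) - T (i : ℤ)) := by
    intro n s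
    rw [Finset.prod_range_succ']
    have e : ∀ i : ℕ, (T ((n + 1 : ℕ) : ℤ) - T ((i + 1 : ℕ) : ℤ) : LaurentPolynomial ℤ) =
        T 1 * (T (n : ℤ) - T (i : ℤ)) := by
      intro i
      rw [mul_sub, ← T_add, ← T_add]
      congr 2 <;> push_cast <;> ring
    simp only [e, Finset.prod_mul_distrib, Finset.prod_const, Finset.card_range, T_pow]
    simp
    ring
  induction s generalizing n with
  | zero => simp [lBinom_zero_right]
  | succ s ih =>
    rcases n with _ | n
    · rw [lBinom_eq_zero (Nat.succ_pos s), zero_mul, Finset.prod_range_succ']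
      simp
    · rw [step, step, ih]
      linear_combination T (s : ℤ) * (∏ i ∈ Finset.range s, (T (s : ℤ) - T (i : ℤ))) *
        lBinom_succ_succ_mul n s

/-- Cauchy's expansion of x^p at x = q^{M+1-p}: the coefficient is [p, s] and the product is [M+1-p,
s] times a factor free of p. -/
theorem T_mul_mem (M : ℕ) :
    (fun p : Fin (M + 1) => (T ((p : ℤ) * (M + 1 - p)) : LaurentPolynomial ℤ)) ∈
      binomPairAlgebra M := by
  refine mem_span_binomPair (M + 1) (fun s => ∏ i ∈ Finset.range s, (T (s : ℤ) - T (i : ℤ))) ?_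
  rintro ⟨p, hp⟩
  have h := pow_eq_sum_prod_sub_pow (T 1) (T ((M + 1 - p : ℕ) : ℤ)) lBinom lBinom_zero_right
    (fun n k => lBinom_eq_zero) (fun n k => by
      rw [lBinom_succ_succ, T_pow]; congr 3; push_cast; ring) hp
  rw [T_pow, Nat.cast_sub (by omega : p ≤ M + 1)] at h
  push_cast at h
  rw [h]
  apply Finset.sum_congr rfl
  intro s _
  have h2 := prod_T_sub_T (M + 1 - p) s
  rw [Nat.cast_sub (by omega : p ≤ M + 1)] at h2
  push_cast at h2
  simp only [T_pow, mul_one, binomPair]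
  rw [h2]
  ring

/-- The same expansion in base q^{-1}, where [n, k] becomes q^{k(k-n)}[n, k]. The extra powers
q^{s(s-p)} and q^{-s(M+1-p)} combine to one free of p (`e4`). -/
theorem T_neg_mul_mem (M : ℕ) :
    (fun p : Fin (M + 1) => (T (-((p : ℤ) * (M + 1 - p))) : LaurentPolynomial ℤ)) ∈
      binomPairAlgebra M := by
  refine mem_span_binomPair (M + 1) (fun s => T ((s : ℤ) * (s - (M + 1))) *
    (∏ i ∈ Finset.range s, -T (-(i : ℤ))) *
      ∏ i ∈ Finset.range s, (T (s : ℤ) - T (i : ℤ))) ?_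
  rintro ⟨p, hp⟩
  have h := pow_eq_sum_prod_sub_pow (T (-1)) (T (-((M + 1 - p : ℕ) : ℤ)))
    (fun n k => T ((k : ℤ) * (k - n)) * lBinom n k) (fun n => by simp [lBinom_zero_right])
    (fun n k h => by simp [lBinom_eq_zero h]) (fun n k => by
      have e1 : (T (((k + 1 : ℕ) : ℤ) * ((k + 1 : ℕ) - (n + 1 : ℕ))) : LaurentPolynomial ℤ) *
        T ((n : ℤ) - k) = T ((k : ℤ) * (k - n)) := by
          rw [← T_add]; congr 1; push_cast; ring
      have e2 : (T (((k + 1 : ℕ) : ℤ) * ((k + 1 : ℕ) - (n + 1 : ℕ))) : LaurentPolynomial ℤ) =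
        T (-1) ^ (k + 1) * T (((k + 1 : ℕ) : ℤ) * ((k + 1 : ℕ) - n)) := by
          rw [T_pow, ← T_add]; congr 1; push_cast; ring
      simp only [lBinom_succ_succ']
      linear_combination lBinom n k * e1 + lBinom n (k + 1) * e2) hp
  rw [T_pow] at h
  have e : (p : ℤ) * -((M + 1 - p : ℕ) : ℤ) = -((p : ℤ) * (M + 1 - p)) := by
    rw [Nat.cast_sub (by omega : p ≤ M + 1)]; push_cast; ring
  rw [e] at h
  rw [h]
  apply Finset.sum_congr rfl
  intro s _
  have e3 : ∏ i ∈ Finset.range s, (T (-((M + 1 - p : ℕ) : ℤ)) - T (-1) ^ i : LaurentPolynomial ℤ) =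
      T ((s : ℤ) * -((M + 1 - p : ℕ) : ℤ)) * (∏ i ∈ Finset.range s, -T (-(i : ℤ))) *
        ∏ i ∈ Finset.range s, (T ((M + 1 - p : ℕ) : ℤ) - T (i : ℤ)) := by
    have ht (z : ℤ) : (T (-z) * T z : LaurentPolynomial ℤ) = 1 := by
      rw [← T_add, neg_add_cancel, T_zero]
    rw [← T_pow, Finset.pow_eq_prod_const, ← Finset.prod_mul_distrib, ← Finset.prod_mul_distrib]
    apply Finset.prod_congr rfl
    intro i _
    rw [T_pow, mul_neg_one]
    linear_combination T (-(i : ℤ)) * ht ((M + 1 - p : ℕ) : ℤ) -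
      T (-((M + 1 - p : ℕ) : ℤ)) * ht i
  have e4 : (T ((s : ℤ) * (s - p)) * T ((s : ℤ) * -((M + 1 - p : ℕ) : ℤ)) : LaurentPolynomial ℤ) =
      T ((s : ℤ) * (s - (M + 1))) := by
    rw [← T_add, Nat.cast_sub (by omega : p ≤ M + 1)]; congr 1; push_cast; ring
  simp only [binomPair, e3]
  rw [prod_T_sub_T (M + 1 - p) s]
  linear_combination lBinom p s * lBinom (M + 1 - p) s * (∏ i ∈ Finset.range s, -T (-(i : ℤ))) *
      (∏ i ∈ Finset.range s, (T (s : ℤ) - T (i : ℤ))) * e4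

/-! ### The square of the q-Catalan triangle number lies in the algebra. -/

/-- The `q`-Catalan triangle number `[M choose p] - [M choose p - 1]`. -/
noncomputable def lCatalan (M : ℕ) : ℕ → LaurentPolynomial ℤ
  | 0 => 1
  | p + 1 => lBinom M (p + 1) - lBinom M p

theorem lBinom_add_left_range_reflect (m n k : ℕ) :
    lBinom (m + n) k = ∑ j ∈ Finset.range (k + 1),
      T ((j : ℤ) * ((m : ℤ) - (k - j))) * lBinom m (k - j) * lBinom n j := by
  rw [lBinom_add_left_range, ← Finset.sum_range_reflect]
  apply Finset.sum_congr rfl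
  intro j hj
  have hj : j ≤ k := Nat.lt_succ_iff.mp (Finset.mem_range.mp hj)
  rw [show k + 1 - 1 - j = k - j by omega, show k - (k - j) = j by omega, Nat.cast_sub hj,
    sub_sub_cancel]

theorem lBinom_symm {n k : ℕ} (h : k ≤ n) : lBinom n (n - k) = lBinom n k := by
  obtain ⟨l, rfl⟩ := Nat.exists_eq_add_of_le h
  rw [Nat.add_sub_cancel_left, lBinom_add_symm]

/-- Term j + 1 of one Vandermonde sum and term j of the other share [c+1, j+1]; the Pascal rule adds
their cofactors to [m+1, j+1]. With p = c + 1 and M = c + 1 + m the summands are multiples of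
B_s(p). -/
theorem lBinom_add_lBinom_eq_sum (c m : ℕ) :
    lBinom (c + 1 + m) (c + 1) + lBinom (c + 1 + m) c = ∑ s ∈ Finset.range (c + 2),
      T ((s : ℤ) * (s - 1)) * (lBinom (c + 1) s * lBinom (m + 1) s) := by
  rw [lBinom_add_left_range_reflect, lBinom_add_left_range_reflect, Finset.sum_range_succ',
    Finset.sum_range_succ' _ (c + 1), add_right_comm, ← Finset.sum_add_distrib]
  congr 1
  · apply Finset.sum_congr rfl
    intro j hj
    have hj : j ≤ c := Nat.lt_succ_iff.mp (Finset.mem_range.mp hj)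
    have h1 : lBinom (c + 1) (c - j) = lBinom (c + 1) (j + 1) := by
      rw [← lBinom_symm (show j + 1 ≤ c + 1 by omega)]; congr 1; omega
    rw [show c + 1 - (j + 1) = c - j by omega, h1, lBinom_succ_succ m j]
    have e1 : (T (((j + 1 : ℕ) : ℤ) * (((c + 1 : ℕ) : ℤ) - (((c + 1 : ℕ) : ℤ) - (j + 1 : ℕ)))) :
        LaurentPolynomial ℤ) = T (((j + 1 : ℕ) : ℤ) * ((j + 1 : ℕ) - 1)) * T ((j : ℤ) + 1) := by
      rw [← T_add]; congr 1; push_cast; ring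
    have e2 : (T ((j : ℤ) * (((c + 1 : ℕ) : ℤ) - ((c : ℤ) - j))) : LaurentPolynomial ℤ) =
        T (((j + 1 : ℕ) : ℤ) * ((j + 1 : ℕ) - 1)) := by
      congr 1; push_cast; ring
    rw [e1, e2]
    ring
  · simp [lBinom_zero_right, lBinom_self]

/-- Saalschütz with x = c+1, y = d+1, a = c, b = d. The prefactor turns the exponent (c-k)(d-k) into
one depending only on k and c + d = M - 1, so the coefficients do not depend on p = c + 1. Swapping
c and d removes the condition c ≤ d. -/
theorem lBinom_mul_lBinom_eq_sum (c d : ℕ) {K : ℕ} (hK : c < K) :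
    T (-(((c : ℤ) + 1) * (d + 1))) * (lBinom (c + d + 1) (c + 1) * lBinom (c + d + 1) c) =
      ∑ k ∈ Finset.range K, T (((k : ℤ) + 1) * (k - 1 - c - d)) * lBinom (c + d + 2 + k) k *
        (lBinom (c + 1) (k + 1) * lBinom (d + 1) (k + 1)) := by
  have main : ∀ c d : ℕ, c ≤ d →
      T (-(((c : ℤ) + 1) * (d + 1))) * (lBinom (c + d + 1) (c + 1) * lBinom (c + d + 1) c) =
      ∑ k ∈ Finset.range (c + 1), T (((k : ℤ) + 1) * (k - 1 - c - d)) * lBinom (c + d + 2 + k) k *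
        (lBinom (c + 1) (k + 1) * lBinom (d + 1) (k + 1)) := by
    intro c d h
    have hG := sum_lBinom_mul_lBinom_mul_lBinom (c + 1) (d + 1) h
    have h1 : lBinom (d + 1 + c) d = lBinom (c + d + 1) (c + 1) := by
      rw [← lBinom_symm (show c + 1 ≤ c + d + 1 by omega)]; congr 1 <;> omega
    rw [h1, show c + 1 + d = c + d + 1 by ring] at hG
    rw [mul_comm (lBinom (c + d + 1) (c + 1)), ← hG, Finset.mul_sum]
    apply Finset.sum_congr rfl
    intro k hk
    have hk : k ≤ c := Nat.lt_succ_iff.mp (Finset.mem_range.mp hk)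
    have h2 : lBinom (c + 1) (c - k) = lBinom (c + 1) (k + 1) := by
      rw [← lBinom_symm (show k + 1 ≤ c + 1 by omega)]; congr 1; omega
    have h3 : lBinom (d + 1) (d - k) = lBinom (d + 1) (k + 1) := by
      rw [← lBinom_symm (show k + 1 ≤ d + 1 by omega)]; congr 1; omega
    have e : (T (-(((c : ℤ) + 1) * (d + 1))) * T (((c : ℤ) - k) * ((d : ℤ) - k)) :
        LaurentPolynomial ℤ) = T (((k : ℤ) + 1) * (k - 1 - c - d)) := by
      rw [← T_add]; congr 1; ring
    rw [h2, h3, ← e, show c + 1 + (d + 1) + k = c + d + 2 + k by ring]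
    ring
  rcases le_or_gt c d with h | h
  · rw [Finset.eventually_constant_sum (N := c + 1) (fun k hk => by
      rw [lBinom_eq_zero (show c + 1 < k + 1 by omega), zero_mul, mul_zero]) hK]
    exact main c d h
  · rw [Finset.eventually_constant_sum (N := d + 1) (fun k hk => by
      rw [lBinom_eq_zero (show d + 1 < k + 1 by omega), mul_zero, mul_zero])
      (show d + 1 ≤ K by omega)]
    have h1 := main d c h.le
    have h2 : lBinom (c + d + 1) (d + 1) = lBinom (c + d + 1) c := by
      rw [← lBinom_symm (show c ≤ c + d + 1 by omega)]; congr 1; omega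
    have h3 : lBinom (c + d + 1) d = lBinom (c + d + 1) (c + 1) := by
      rw [← lBinom_symm (show c + 1 ≤ c + d + 1 by omega)]; congr 1; omega
    rw [add_comm d c, h2, h3] at h1
    rw [mul_comm ((c : ℤ) + 1), mul_comm (lBinom (c + d + 1) (c + 1)), h1]
    apply Finset.sum_congr rfl
    intro k _
    rw [mul_comm (lBinom (d + 1) (k + 1)), sub_right_comm]

/-- (u - v)^2 = (u + v)^2 - 4uv with u = [M, p], v = [M, p-1]. The sum lies in the span directly; uv
does so after a twist by q^{-p(M+1-p)}, which `T_mul_mem` undoes. -/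
theorem lCatalan_sq_mem (M : ℕ) :
    (fun p : Fin (M + 1) => lCatalan M p ^ 2) ∈ binomPairAlgebra M := by
  let prev : ℕ → LaurentPolynomial ℤ := fun p => Nat.casesOn p 0 fun c => lBinom M c
  have hE : (fun p : Fin (M + 1) => lBinom M p + prev p) ∈ binomPairAlgebra M := by
    refine mem_span_binomPair (M + 1) (fun s => T ((s : ℤ) * (s - 1))) ?_
    rintro ⟨p, hp⟩
    rw [Finset.eventually_constant_sum (N := p + 1) (fun s hs => by
      simp only [binomPair]
      rw [lBinom_eq_zero (show p < s by omega), zero_mul, mul_zero]) hp]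
    rcases p with _ | c
    · simp [prev, binomPair, lBinom_zero_right]
    · have h := lBinom_add_lBinom_eq_sum c (M - (c + 1))
      rw [show c + 1 + (M - (c + 1)) = M by omega,
        show M - (c + 1) + 1 = M + 1 - (c + 1) by omega] at h
      exact h
  have hD : (fun p : Fin (M + 1) => T (-((p : ℤ) * (M + 1 - p))) * (lBinom M p * prev p)) ∈
      binomPairAlgebra M := by
    -- The expansion of uv starts at s = 1, so the coefficient at s = 0 is zero.
    refine mem_span_binomPair (M + 1 + 1) (fun s => Nat.casesOn s 0 fun k =>
      T (((k : ℤ) + 1) * (k - M)) * lBinom (M + 1 + k) k) ?_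
    rintro ⟨p, hp⟩
    rw [Finset.sum_range_succ']
    rcases p with _ | c
    · simp [prev, binomPair, lBinom_eq_zero]
    · obtain ⟨d, rfl⟩ : ∃ d, M = c + d + 1 := ⟨M - c - 1, by omega⟩
      have h := lBinom_mul_lBinom_eq_sum c d (show c < c + d + 1 + 1 by omega)
      have e1 : -(((c : ℤ) + 1) * (d + 1)) =
          -(((c + 1 : ℕ) : ℤ) * (((c + d + 1 : ℕ) : ℤ) + 1 - (c + 1 : ℕ))) := by push_cast; ring
      rw [e1] at h
      refine h.trans (Eq.trans ?_ (add_eq_left.mpr (zero_mul _)).symm)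
      apply Finset.sum_congr rfl
      intro k _
      simp only [binomPair]
      rw [show c + d + 1 + 1 - (c + 1) = d + 1 by omega]
      congr 4
      push_cast; ring
  have h := sub_mem (pow_mem hE 2)
    (mul_mem (algebraMap_mem (binomPairAlgebra M) 4) (mul_mem (T_mul_mem M) hD))
  convert h using 1
  ext1 ⟨p, hp⟩
  have ht (z : ℤ) : (T z * T (-z) : LaurentPolynomial ℤ) = 1 := by
    rw [← T_add, add_neg_cancel, T_zero]
  simp only [Pi.sub_apply, Pi.pow_apply, Pi.mul_apply, Pi.algebraMap_apply, Algebra.algebraMap_self,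
    RingHom.id_apply]
  rw [← mul_assoc (T _), ht, one_mul]
  rcases p with _ | c
  · simp [lCatalan, prev, lBinom_zero_right]
  · simp only [lCatalan, prev]
    ring

/-! ### Telescoping and divisibility. -/

theorem sum_lCatalan_mul {M a : ℕ} (s : ℕ) (h : a ≤ M) :
    ∑ p ∈ Finset.range (a + 1), lCatalan M p * (lBinom p s * lBinom (M + 1 - p) s) =
      T (s : ℤ) * lBinom M a * lBinom a s * lBinom (M - a) s := by
  induction a with
  | zero =>
    rcases s with _ | s
    · simp [lCatalan, lBinom_zero_right]
    · simp [lBinom_eq_zero]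
  | succ c ih =>
    rw [Finset.sum_range_succ, ih (by omega)]
    obtain ⟨m, rfl⟩ := Nat.exists_eq_add_of_le h
    rw [show c + 1 + m - c = m + 1 by omega, show c + 1 + m + 1 - (c + 1) = m + 1 by omega,
      Nat.add_sub_cancel_left]
    have h1 := lBinom_succ_left_mul c s
    have h2 := lBinom_succ_left_mul m s
    have h3 := lBinom_succ_succ_mul (c + m) c
    have h4 := lBinom_succ_left_mul (c + m) c
    rw [show ((c + m : ℕ) : ℤ) + 1 - c = m + 1 by push_cast; ring] at h4
    rw [show c + m + 1 = c + 1 + m by ring] at h3 h4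
    have e1 : (T (s : ℤ) * T ((c : ℤ) + 1 - s) : LaurentPolynomial ℤ) = T ((c : ℤ) + 1) := by
      rw [← T_add]; congr 1; ring
    have e2 : (T (s : ℤ) * T ((m : ℤ) + 1 - s) : LaurentPolynomial ℤ) = T ((m : ℤ) + 1) := by
      rw [← T_add]; congr 1; ring
    simp only [lCatalan]
    -- Clearing these denominators leaves an identity that follows linearly from the absorption
    -- rules.
    apply mul_right_cancel₀ (mul_ne_zero (one_sub_T_ne_zero c) (one_sub_T_ne_zero m))
    generalize lBinom (c + 1 + m) (c + 1) = X at *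
    generalize lBinom (c + 1 + m) c = Y at *
    have h5 : X * (1 - T ((c : ℤ) + 1)) = Y * (1 - T ((m : ℤ) + 1)) := h3.trans h4.symm
    generalize lBinom (c + 1) s = u' at *
    generalize lBinom c s = u at *
    generalize lBinom (m + 1) s = v' at *
    generalize lBinom m s = v at *
    generalize (T ((c : ℤ) + 1 - s) : LaurentPolynomial ℤ) = tcs at *
    generalize (T ((m : ℤ) + 1 - s) : LaurentPolynomial ℤ) = tms at *
    generalize (T ((c : ℤ) + 1) : LaurentPolynomial ℤ) = tc at *
    generalize (T ((m : ℤ) + 1) : LaurentPolynomial ℤ) = tm at *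
    generalize (T (s : ℤ) : LaurentPolynomial ℤ) = ts at *
    linear_combination u' * v' * (1 - ts) * h5 - ts * Y * v' * (1 - tm) * h1 +
      ts * X * u' * (1 - tc) * h2 - Y * v' * u' * (1 - tm) * e1 + X * u' * v' * (1 - tc) * e2

theorem lBinom_dvd_sum_mul {M a : ℕ} (h : a ≤ M) {f : Fin (M + 1) → LaurentPolynomial ℤ}
    (hf : f ∈ binomPairAlgebra M) :
    lBinom M a ∣ ∑ p : Fin (a + 1), lCatalan M p * f (Fin.castLE (by omega) p) := by
  rw [mem_binomPairAlgebra] at hf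
  induction hf using Submodule.span_induction with
  | mem f hf =>
    obtain ⟨s, rfl⟩ := hf
    simp only [binomPair, Fin.val_castLE]
    rw [Fin.sum_univ_eq_sum_range
      (fun p => lCatalan M p * (lBinom p s * lBinom (M + 1 - p) s)), sum_lCatalan_mul s h]
    exact ⟨T (s : ℤ) * lBinom a s * lBinom (M - a) s, by ring⟩
  | zero => simp
  | add f g _ _ hf hg =>
    simp only [Pi.add_apply, mul_add, Finset.sum_add_distrib]
    exact dvd_add hf hg
  | smul c f _ hf =>
    simp only [Pi.smul_apply, smul_eq_mul, mul_left_comm _ c, ← Finset.mul_sum]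
    exact dvd_mul_of_dvd_right hf c

/-- One factor of the odd power drives the telescoping; the other 2r form a power of the square,
which lies in the algebra. -/
theorem lBinom_dvd_sum_lCatalan_pow {M a : ℕ} (r j : ℕ) (h : a ≤ M) :
    lBinom M a ∣ ∑ p ∈ Finset.range (a + 1),
      lCatalan M p ^ (2 * r + 1) * T (-((p : ℤ) * (M + 1 - p))) ^ j := by
  have hf := lBinom_dvd_sum_mul h
    (mul_mem (pow_mem (lCatalan_sq_mem M) r) (pow_mem (T_neg_mul_mem M) j))
  convert hf using 1
  rw [← Fin.sum_univ_eq_sum_range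
    (fun p => lCatalan M p ^ (2 * r + 1) * T (-((p : ℤ) * (M + 1 - p))) ^ j)]
  apply Finset.sum_congr rfl
  intro p _
  simp only [Pi.mul_apply, Pi.pow_apply, Fin.val_castLE]
  ring

/-! ### Return to A_{n,k}(q). -/

theorem qBinom_natCast (n k : ℕ) : qBinom n (k : ℤ) = qBinomNat n k := by simp [qBinom]

theorem toLaurent_qA {n p : ℕ} (h : p ≤ n) : toLaurent (qA n (n - p)) = lCatalan (2 * n) p := by
  rw [qA, Nat.cast_sub h, sub_sub_cancel, qBinom_natCast]
  rcases p with _ | p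
  · simp [qBinom, qBinomNat_zero_right, lCatalan]
  · rw [show ((p + 1 : ℕ) : ℤ) - 1 = p by push_cast; ring, qBinom_natCast, map_sub]
    rfl

theorem sum_Icc_eq_sum_range_sub {R : Type*} [AddCommMonoid R] {n a : ℕ} (h : a ≤ n) (f : ℕ → R) :
    ∑ k ∈ Finset.Icc a n, f k = ∑ p ∈ Finset.range (n - a + 1), f (n - p) := by
  refine Finset.sum_nbij' (fun k => n - k) (fun p => n - p) ?_ ?_ ?_ ?_ ?_ <;>
    intro k hk <;> simp only [Finset.mem_Icc, Finset.mem_range] at hk ⊢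
  all_goals first | omega | (congr 1; omega)

theorem qCongZero_sum_qA_pow {n a : ℕ} (r j : ℕ) (h : a ≤ n) :
    QCongZero (toLaurent (∑ k ∈ Finset.Icc a n, qA n k ^ (2 * r + 1) * X ^ (j * (k ^ 2 + k))))
      (qBinom (2 * n) ((n : ℤ) - a)) := by
  rw [← Nat.cast_sub h, qBinom_natCast, sum_Icc_eq_sum_range_sub h, map_sum]
  -- The unit q^{jn(n+1)} turns q^{-jp(2n+1-p)} into q^{j(k^2+k)} for k = n - p.
  have hd := dvd_mul_of_dvd_right
    (lBinom_dvd_sum_lCatalan_pow r j (show n - a ≤ 2 * n by omega)) (T ((n : ℤ) * (n + 1)) ^ j)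
  change lBinom (2 * n) (n - a) ∣ _
  convert hd using 1
  rw [Finset.mul_sum]
  apply Finset.sum_congr rfl
  intro p hp
  have hp : p ≤ n := by have := Finset.mem_range.mp hp; omega
  rw [map_mul, map_pow, toLaurent_qA hp, toLaurent_X_pow, mul_left_comm, ← mul_pow, ← T_add, T_pow]
  congr 2
  push_cast [hp]
  ring

/-! ### Specialization at q = 1. -/

/-- Specialization of Laurent polynomials at `q = 1`. -/
noncomputable def evalOne : LaurentPolynomial ℤ →+* ℤ := eval₂ (RingHom.id ℤ) 1

theorem evalOne_T (z : ℤ) : evalOne (T z) = 1 := by simp [evalOne]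

theorem evalOne_lBinom (n k : ℕ) : evalOne (lBinom n k) = n.choose k := by
  induction n generalizing k with
  | zero =>
    rcases k with _ | k
    · simp [lBinom_zero_right]
    · simp [lBinom_eq_zero]
  | succ n ih =>
    rcases k with _ | k
    · simp [lBinom_zero_right]
    · rw [lBinom_succ_succ, map_add, map_mul, evalOne_T, ih, ih, Nat.choose_succ_succ]
      push_cast; ring

/-- Multiplied by M + 1, the two binomials become (M+1-p) and p times binom(M+1, p); hence the shift
to M + 1. -/
theorem evalOne_lCatalan (M p : ℕ) : evalOne (lCatalan M p) = cNum (M + 1) p := by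
  have h := mul_cNum (Nat.succ_pos M) p
  apply mul_left_cancel₀ (show ((M + 1 : ℕ) : ℤ) ≠ 0 by positivity)
  rw [h]
  rcases p with _ | c
  · simp [lCatalan]
  · simp only [lCatalan, map_sub, evalOne_lBinom]
    have h1 : ((M : ℤ) + 1) * (M.choose c : ℤ) = ((M + 1).choose (c + 1) : ℤ) * ((c : ℤ) + 1) := by
      exact_mod_cast Nat.add_one_mul_choose_eq M c
    have h2 : ((M + 1).choose (c + 1) : ℤ) = M.choose c + M.choose (c + 1) := by
      exact_mod_cast Nat.choose_succ_succ M c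
    push_cast
    linear_combination (-(M : ℤ) - 1) * h2 - 2 * h1

theorem choose_dvd_sum_cNum_pow {M a : ℕ} (r : ℕ) (h : a ≤ M) :
    (M.choose a : ℤ) ∣ ∑ p ∈ Finset.range (a + 1), cNum (M + 1) p ^ (2 * r + 1) := by
  have hd := map_dvd evalOne (lBinom_dvd_sum_lCatalan_pow r 0 h)
  simpa only [pow_zero, mul_one, map_sum, map_pow, evalOne_lCatalan, evalOne_lBinom] using hd

theorem choose_dvd_sum_aNum_pow {n a : ℕ} (r : ℕ) (h : a ≤ n) :
    ((2 * n).choose (n - a) : ℤ) ∣ ∑ k ∈ Finset.Icc a n, aNum n k ^ (2 * r + 1) := by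
  rw [sum_Icc_eq_sum_range_sub h]
  convert choose_dvd_sum_cNum_pow r (show n - a ≤ 2 * n by omega) using 1
  apply Finset.sum_congr rfl
  intro p hp
  have hp := Finset.mem_range.mp hp
  rw [aNum_eq_cNum (Nat.sub_le n p), show n - (n - p) = p by omega]

end CatalanTriangle

theorem mainTheorem4 :
    (∀ n a r j : ℕ, 1 ≤ n → a ≤ n → j ≤ 2 * r + 1 →
      CatalanTriangle.QCongZero
        (Polynomial.toLaurent
          (∑ k ∈ Finset.Icc a n,
            CatalanTriangle.qA n k ^ (2 * r + 1) * Polynomial.X ^ (j * (k ^ 2 + k))))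
        (CatalanTriangle.qBinom (2 * n) ((n : ℤ) - a))) ∧
    (∀ n a r : ℕ, 1 ≤ n → a ≤ n →
      ((2 * n).choose (n - a) : ℤ) ∣
        ∑ k ∈ Finset.Icc a n, CatalanTriangle.aNum n k ^ (2 * r + 1)) ∧
    (∀ n a r : ℕ, 1 ≤ a → a < n →
      ((n - 1).choose a : ℤ) ∣
        ∑ k ∈ Finset.Icc 0 a, CatalanTriangle.cNum n k ^ (2 * r + 1)) := by
  refine ⟨fun n a r j _ h _ => CatalanTriangle.qCongZero_sum_qA_pow r j h,
    fun n a r _ h => CatalanTriangle.choose_dvd_sum_aNum_pow r h, fun n a r _ h => ?_⟩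
  obtain ⟨M, rfl⟩ : ∃ M, n = M + 1 := ⟨n - 1, by omega⟩
  rw [Nat.add_sub_cancel, ← Nat.range_succ_eq_Icc_zero]
  exact CatalanTriangle.choose_dvd_sum_cNum_pow r (Nat.lt_succ_iff.mp h)
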